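/- Let $A$ be the renewal transition matrix on the alphabet $\mathbb N=\{1,2,3,\dots\}$: $A(1,n)=A(n+1,n)=1$ for all $n\in\mathbb N$, and all other entries are $0$. Let $\Sigma_A=\{x_0x_1x_2\cdots : x_j\in\mathbb N,\ A(x_j,x_{j+1})=1 \text{ for all } j\ge 0\}$ be its Markov shift space. On $\ell^2(\Sigma_A)$, with canonical basis $(\delta_x)_{x\in\Sigma_A}$, let $T_s$ ($s\in\mathbb N$) be the partial isometry with $T_s\delta_x=\delta_{sx}$ if $A(s,x_0)=1$ and $T_s\delta_x=0$ otherwise, and let $Q_s=T_s^*T_s$. Let $\mathcal D_A$ be the commutative unital $C^*$-algebra obtained as the norm closure of the linear span of the operators $T_\alpha\bigl(\prod_{i\in F}Q_i\bigr)T_\alpha^*$, where $\alpha$ is a finite, possibly empty, word, $T_\alpha$ is the product of the $T_s$ over the letters of $\alpha$, and $F\subset\mathbb N$ is finite. Let $X_A$ be the spectrum (space of characters) of $\mathcal D_A$. Let $\mathbb F$ be the free group on $\mathbb N$, with identity $e$, and let $\mathbb F_+$ be the unital sub-semigroup generated by $\mathbb N$. For $g\in\mathbb F$ with reduced form $x_1\cdots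 x_n$ put $T_g=T_{x_1}\cdots T_{x_n}$, where $T_{s^{-1}}=T_s^*$, and $e_g=T_gT_g^*\in\mathcal D_A$. Identify $X_A$ with a subset of $\{0,1\}^{\mathbb F}$ through $\varphi\mapsto(\varphi(e_g))_{g\in\mathbb F}$, and $\Sigma_A$ with a subset of $X_A$ through $x\mapsto\bigl(R\mapsto(R\delta_x,\delta_x)\bigr)$. Put $Y_A=X_A\setminus\Sigma_A$. The stem of a configuration $\xi\in X_A\subset\{0,1\}^{\mathbb F}$ is the unique finite (possibly empty) or infinite word $\omega=\omega_0\omega_1\cdots$ with $A(\omega_j,\omega_{j+1})=1$ for all $j$ such that $\{g\in\mathbb F:\xi_g=1\}\cap\mathbb F_+=\{e,\omega_0,\omega_0\omega_1,\omega_0\omega_1\omega_2,\dots\}$. Let $\xi^0\in\{0,1\}^{\mathbb F}$ be the configuration with $\xi^0_g=1$ if and only if $g=e$ or $g=\omega^{-1}$ for a nonempty finite admissible word $\omega$ (that is, $A(\omega_j,\omega_{j+1})=1$ for all consecutive letters) whose last letter is $1$. Then exactly one element of $Y_A$ has stem of length zero, namely $\xi^0$; and for every $n\ge 1$, exactly $2^{n-1}$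 elements of $Y_A$ have stem of length $n$. -/

import Mathlib

noncomputable section

namespace RenewalShift

open Classical

/-! A transition matrix with entries in `{0, 1}` on the alphabet `{1, 2, 3, …}` is given by the
relation `A i j`, meaning that the entry at `(i, j)` is `1`. -/

/-- The renewal transition matrix: `A(1, n) = A(n + 1, n) = 1`, and all other entries are `0`. -/
def renewal (i j : ℕ+) : Prop := i = 1 ∨ i = j + 1

/-- The Markov shift space `Σ_A`. -/
@[ext]
structure Shift (A : ℕ+ → ℕ+ → Prop) : Type where
  val : ℕ → ℕ+
  property : ∀ j, A (val j) (val (j + 1))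

variable {A : ℕ+ → ℕ+ → Prop}

/-- The shift map `x₀x₁x₂⋯ ↦ x₁x₂x₃⋯`. -/
def Shift.tail (x : Shift A) : Shift A := ⟨fun j => x.1 (j + 1), fun j => x.2 (j + 1)⟩

/-- The sequence `s x₀ x₁ ⋯`, when `A(s, x₀) = 1`. -/
def Shift.cons (s : ℕ+) (x : Shift A) (h : A s (x.1 0)) : Shift A :=
  ⟨fun j => Nat.casesOn j s x.1, fun j => by cases j with
    | zero => exact h
    | succ k => exact x.2 k⟩

theorem Shift.tail_cons (s : ℕ+) (x : Shift A) (h : A s (x.1 0)) : (x.cons s h).tail = x := rfl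

theorem Shift.cons_tail (x : Shift A) : x.tail.cons (x.1 0) (x.2 0) = x := by
  apply Shift.ext
  funext j
  cases j <;> rfl

theorem Shift.eq_of_tail_eq {x y : Shift A} (h : x.tail = y.tail) (h0 : x.1 0 = y.1 0) :
    x = y := by
  apply Shift.ext
  funext j
  cases j with
  | zero => exact h0
  | succ k => exact congrFun (congrArg Shift.val h) k

/-- The Hilbert space `ℓ²(Σ_A)`. -/
abbrev Hilb (A : ℕ+ → ℕ+ → Prop) : Type := lp (fun _ : Shift A => ℂ) 2

/-- The canonical basis vector `δ_x` of `ℓ²(Σ_A)`. -/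
def basisVec (x : Shift A) : Hilb A := lp.single 2 x (1 : ℂ)

theorem isometryFun_aux (s : ℕ+) (f : Hilb A) :
    (Summable fun y : Shift A =>
      ‖(if y.1 0 = s then f y.tail else 0 : ℂ)‖ ^ (2 : ENNReal).toReal) ∧
    (∑' y : Shift A, ‖(if y.1 0 = s then f y.tail else 0 : ℂ)‖ ^ (2 : ENNReal).toReal)
      ≤ ∑' y : Shift A, ‖f y‖ ^ (2 : ENNReal).toReal := by
  have hp : 0 < (2 : ENNReal).toReal := by norm_num
  have hf : Summable fun y : Shift A => ‖f y‖ ^ (2 : ENNReal).toReal :=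
    (memℓp_gen_iff hp).1 f.2
  let S : Set (Shift A) := {y | y.1 0 = s}
  have hinj : Function.Injective (fun y : S => (y : Shift A).tail) := by
    intro y z h
    exact Subtype.ext (Shift.eq_of_tail_eq h ((show _ = s from y.2).trans (show _ = s from z.2).symm))
  have hcongr : (fun y : Shift A =>
      ‖(if y.1 0 = s then f y.tail else 0 : ℂ)‖ ^ (2 : ENNReal).toReal) =
      S.indicator (fun y => ‖f y.tail‖ ^ (2 : ENNReal).toReal) := by
    funext y
    by_cases hy : y.1 0 = s
    · simp [S, Set.indicator, hy]
    · simp [S, Set.indicator, hy]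
  rw [hcongr]
  refine ⟨summable_subtype_iff_indicator.1 (hf.comp_injective hinj), ?_⟩
  rw [← tsum_subtype]
  exact tsum_comp_le_tsum_of_inj hf (fun _ => by positivity) hinj

/-- The partial isometry `T_s` on `ℓ²(Σ_A)`, with `T_s δ_x = δ_{sx}` if `A(s, x₀) = 1` and
`T_s δ_x = 0` otherwise; that is, `(T_s f)(y) = f(σ(y))` if `y₀ = s`, and `0` otherwise. -/
def T (A : ℕ+ → ℕ+ → Prop) (s : ℕ+) : Hilb A →L[ℂ] Hilb A :=
  LinearMap.mkContinuous
    { toFun := fun f => ⟨fun y => if y.1 0 = s then f y.tail else 0,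
        memℓp_gen (isometryFun_aux s f).1⟩
      map_add' := fun f g => by
        ext y
        change (if y.1 0 = s then f y.tail + g y.tail else 0 : ℂ) =
          (if y.1 0 = s then f y.tail else 0) + (if y.1 0 = s then g y.tail else 0)
        by_cases h : y.1 0 = s <;> simp [h]
      map_smul' := fun c f => by
        ext y
        by_cases h : y.1 0 = s <;> simp [h] }
    1 (fun f => by
      have hp : 0 < (2 : ENNReal).toReal := by norm_num
      rw [one_mul]
      refine lp.norm_le_of_tsum_le hp (norm_nonneg _) ?_
      rw [lp.norm_rpow_eq_tsum hp f]
      exact (isometryFun_aux s f).2)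

theorem T_apply (s : ℕ+) (f : Hilb A) (y : Shift A) :
    T A s f y = if y.1 0 = s then f y.tail else 0 := rfl

theorem T_basisVec (s : ℕ+) (x : Shift A) :
    T A s (basisVec x) = if h : A s (x.1 0) then basisVec (x.cons s h) else 0 := by
  ext y
  rw [T_apply]
  by_cases h : A s (x.1 0)
  · rw [dif_pos h]
    by_cases hy : y = x.cons s h
    · subst hy
      rw [if_pos (show (x.cons s h).1 0 = s from rfl), Shift.tail_cons]
      simp [basisVec]
    · have : ¬ (y.1 0 = s ∧ y.tail = x) := fun hh =>
        hy (Shift.eq_of_tail_eq (hh.2.trans (Shift.tail_cons s x h).symm) hh.1)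
      by_cases h0 : y.1 0 = s
      · have h1 : y.tail ≠ x := fun h1 => this ⟨h0, h1⟩
        simp [basisVec, h0, h1, hy]
      · simp [basisVec, h0, hy]
  · rw [dif_neg h]
    by_cases h0 : y.1 0 = s
    · have h1 : y.tail ≠ x := by
        rintro rfl
        exact h (h0 ▸ y.2 0)
      simp [basisVec, h1]
    · simp [h0]

theorem inner_basisVec (x : Shift A) (f : Hilb A) : inner ℂ (basisVec x) f = f x := by
  simp [basisVec, lp.inner_single_left]

theorem star_T_apply (s : ℕ+) (f : Hilb A) (x : Shift A) :
    star (T A s) f x = if h : A s (x.1 0) then f (x.cons s h) else 0 := by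
  rw [← inner_basisVec, ContinuousLinearMap.star_eq_adjoint,
    ContinuousLinearMap.adjoint_inner_right, T_basisVec]
  by_cases h : A s (x.1 0)
  · rw [dif_pos h, dif_pos h, inner_basisVec]
  · rw [dif_neg h, dif_neg h, inner_zero_left]

/-- The projection `Q_s = T_s* T_s`. -/
def Q (A : ℕ+ → ℕ+ → Prop) (s : ℕ+) : Hilb A →L[ℂ] Hilb A := star (T A s) * T A s

/-- `R` is the diagonal projection given by the indicator function of `U`. -/
def IsDiag (R : Hilb A →L[ℂ] Hilb A) (U : Set (Shift A)) : Prop :=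
  ∀ f x, R f x = if x ∈ U then f x else 0

theorem IsDiag.unique {R S : Hilb A →L[ℂ] Hilb A} {U : Set (Shift A)}
    (hR : IsDiag R U) (hS : IsDiag S U) : R = S := by
  ext f x
  rw [hR f x, hS f x]

theorem IsDiag.mul {R S : Hilb A →L[ℂ] Hilb A} {U V : Set (Shift A)}
    (hR : IsDiag R U) (hS : IsDiag S V) : IsDiag (R * S) (U ∩ V) := by
  intro f x
  rw [mul_apply_eq_comp, hR, hS]
  by_cases h1 : x ∈ U <;> by_cases h2 : x ∈ V <;> simp [h1, h2]

theorem IsDiag.one : IsDiag (1 : Hilb A →L[ℂ] Hilb A) Set.univ := by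
  intro f x
  simp

theorem IsDiag.eq_zero {R : Hilb A →L[ℂ] Hilb A} (hR : IsDiag R ∅) : R = 0 := by
  ext f x
  rw [hR f x]
  simp

theorem IsDiag.star {R : Hilb A →L[ℂ] Hilb A} {U : Set (Shift A)} (hR : IsDiag R U) :
    star R = R := by
  have hd : ∀ x : Shift A, R (basisVec x) = if x ∈ U then basisVec x else 0 := by
    intro x
    ext y
    rw [hR]
    by_cases hxy : y = x
    · subst hxy
      by_cases hy : y ∈ U <;> simp [hy]
    · by_cases hy : y ∈ U <;> by_cases hx : x ∈ U <;> simp [hy, hx, basisVec, hxy]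
  ext f x
  rw [← inner_basisVec, ContinuousLinearMap.star_eq_adjoint,
    ContinuousLinearMap.adjoint_inner_right, hd, hR]
  by_cases hx : x ∈ U
  · simp [hx, inner_basisVec]
  · simp [hx]

theorem IsDiag.conj_T {R : Hilb A →L[ℂ] Hilb A} {U : Set (Shift A)} (hR : IsDiag R U)
    (s : ℕ+) : IsDiag (T A s * R * Star.star (T A s)) {x | x.1 0 = s ∧ x.tail ∈ U} := by
  intro f x
  rw [mul_apply_eq_comp, mul_apply_eq_comp, T_apply, hR, star_T_apply]
  by_cases h : x.1 0 = s
  · subst h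
    have h1 : A (x.1 0) (x.tail.1 0) := x.2 0
    have h2 : x.tail.cons (x.1 0) h1 = x := x.cons_tail
    by_cases h3 : x.tail ∈ U
    · simp [h1, h2, h3]
    · simp [h3]
  · simp [h]

theorem IsDiag.conj_star_T {R : Hilb A →L[ℂ] Hilb A} {U : Set (Shift A)} (hR : IsDiag R U)
    (s : ℕ+) : IsDiag (Star.star (T A s) * R * T A s)
      {x | ∃ h : A s (x.1 0), x.cons s h ∈ U} := by
  intro f x
  rw [mul_apply_eq_comp, mul_apply_eq_comp, star_T_apply]
  by_cases h : A s (x.1 0)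
  · have h0 : (x.cons s h).1 0 = s := rfl
    rw [dif_pos h, hR, T_apply, if_pos h0, Shift.tail_cons]
    simp [h]
  · simp [h]

theorem isDiag_Q (s : ℕ+) : IsDiag (Q A s) {x | A s (x.1 0)} := by
  have h := IsDiag.conj_star_T (IsDiag.one (A := A)) s
  rw [mul_one] at h
  simpa [Q] using h

theorem Q_comm (i j : ℕ+) : Commute (Q A i) (Q A j) :=
  ((isDiag_Q i).mul (isDiag_Q j)).unique
    (by rw [Set.inter_comm]; exact (isDiag_Q j).mul (isDiag_Q i))

/-- The product of the commuting projections `Q_i`, `i ∈ F`. -/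
def prodQ (A : ℕ+ → ℕ+ → Prop) (F : Finset ℕ+) : Hilb A →L[ℂ] Hilb A :=
  F.noncommProd (Q A) (fun i _ j _ _ => Q_comm i j)

/-- `T_α = T_{α₀} ⋯ T_{α_t}` for a finite word `α`. -/
def TWord (A : ℕ+ → ℕ+ → Prop) (α : List ℕ+) : Hilb A →L[ℂ] Hilb A := (α.map (T A)).prod

/-- The operator `T_α (∏_{i ∈ F} Q_i) T_α*`. -/
def gen (A : ℕ+ → ℕ+ → Prop) (α : List ℕ+) (F : Finset ℕ+) : Hilb A →L[ℂ] Hilb A :=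
  TWord A α * prodQ A F * star (TWord A α)

/-- The set of `x = α y` in `Σ_A` with `A(i, y₀) = 1` for all `i ∈ F`. -/
def cyl (A : ℕ+ → ℕ+ → Prop) : List ℕ+ → Finset ℕ+ → Set (Shift A)
  | [], F => {x | ∀ i ∈ F, A i (x.1 0)}
  | a :: α, F => {x | x.1 0 = a ∧ x.tail ∈ cyl A α F}

theorem isDiag_prodQ (F : Finset ℕ+) : IsDiag (prodQ A F) (cyl A [] F) := by
  induction F using Finset.induction_on with
  | empty =>
    have h : prodQ A ∅ = 1 := Finset.noncommProd_empty _ _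
    have h2 : cyl A [] ∅ = Set.univ := by simp [cyl]
    rw [h, h2]
    exact IsDiag.one
  | insert a F ha ih =>
    have h : prodQ A (insert a F) = Q A a * prodQ A F :=
      Finset.noncommProd_insert_of_notMem _ _ _ _ ha
    have h2 : cyl A [] (insert a F) = {x | A a (x.1 0)} ∩ cyl A [] F := by
      ext x
      simp [cyl]
    rw [h, h2]
    exact (isDiag_Q a).mul ih

theorem isDiag_gen (α : List ℕ+) (F : Finset ℕ+) : IsDiag (gen A α F) (cyl A α F) := by
  induction α with
  | nil => simpa [gen, TWord] using isDiag_prodQ (A := A) F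
  | cons a α ih =>
    have h : gen A (a :: α) F = T A a * gen A α F * star (T A a) := by
      simp [gen, TWord, mul_assoc]
    rw [h]
    exact ih.conj_T a

theorem cyl_inter (α β : List ℕ+) (F G : Finset ℕ+) :
    cyl A α F ∩ cyl A β G = ∅ ∨ ∃ γ H, cyl A α F ∩ cyl A β G = cyl A γ H := by
  induction α generalizing β with
  | nil =>
    cases β with
    | nil =>
      refine Or.inr ⟨[], F ∪ G, ?_⟩
      ext x
      simp only [cyl, Set.mem_inter_iff, Set.mem_ofPred_eq, Finset.mem_union]
      grind
    | cons b β =>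
      by_cases h : ∀ i ∈ F, A i b
      · refine Or.inr ⟨b :: β, G, ?_⟩
        ext x
        simp only [cyl, Set.mem_inter_iff, Set.mem_ofPred_eq]
        grind
      · left
        ext x
        simp only [cyl, Set.mem_inter_iff, Set.mem_ofPred_eq, Set.mem_empty_iff_false]
        grind
  | cons a α ih =>
    cases β with
    | nil =>
      by_cases h : ∀ i ∈ G, A i a
      · refine Or.inr ⟨a :: α, F, ?_⟩
        ext x
        simp only [cyl, Set.mem_inter_iff, Set.mem_ofPred_eq]
        grind
      · left
        ext x
        simp only [cyl, Set.mem_inter_iff, Set.mem_ofPred_eq, Set.mem_empty_iff_false]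
        grind
    | cons b β =>
      have key : cyl A (a :: α) F ∩ cyl A (b :: β) G =
          {x | x.1 0 = a ∧ a = b ∧ x.tail ∈ cyl A α F ∩ cyl A β G} := by
        ext x
        simp only [cyl, Set.mem_inter_iff, Set.mem_ofPred_eq]
        grind
      rw [key]
      by_cases hab : a = b
      · rcases ih β with h | ⟨γ, H, h⟩
        · left
          rw [h]
          simp
        · refine Or.inr ⟨a :: γ, H, ?_⟩
          rw [h]
          ext x
          simp [cyl, hab]
      · left
        simp [hab]

theorem cyl_preimage (s : ℕ+) (α : List ℕ+) (F : Finset ℕ+) :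
    {x : Shift A | ∃ h : A s (x.1 0), x.cons s h ∈ cyl A α F} = ∅ ∨
      ∃ γ H, {x : Shift A | ∃ h : A s (x.1 0), x.cons s h ∈ cyl A α F} = cyl A γ H := by
  cases α with
  | nil =>
    by_cases h : ∀ i ∈ F, A i s
    · refine Or.inr ⟨[], {s}, ?_⟩
      ext x
      simp only [cyl, Set.mem_ofPred_eq, Finset.mem_singleton, forall_eq]
      exact ⟨fun h => h.1, fun hx => ⟨hx, h⟩⟩
    · left
      ext x
      simp only [cyl, Set.mem_ofPred_eq, Set.mem_empty_iff_false, iff_false]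
      exact fun hx => h hx.2
  | cons a α =>
    have key : {x : Shift A | ∃ h : A s (x.1 0), x.cons s h ∈ cyl A (a :: α) F} =
        {x | s = a ∧ x ∈ cyl A [] {s} ∩ cyl A α F} := by
      ext x
      simp only [cyl, Set.mem_ofPred_eq, Set.mem_inter_iff, Finset.mem_singleton, forall_eq]
      constructor
      · rintro ⟨h, h1, h2⟩
        exact ⟨h1, h, h2⟩
      · rintro ⟨h1, h, h2⟩
        exact ⟨h, h1, h2⟩
    rw [key]
    by_cases hs : s = a
    · simpa [hs] using cyl_inter (A := A) [] α {a} F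
    · left
      simp [hs]

theorem gen_mul_mem (α β : List ℕ+) (F G : Finset ℕ+) :
    gen A α F * gen A β G ∈
      Submodule.span ℂ (Set.range fun p : List ℕ+ × Finset ℕ+ => gen A p.1 p.2) := by
  have hd := (isDiag_gen (A := A) α F).mul (isDiag_gen β G)
  rcases cyl_inter (A := A) α β F G with h | ⟨γ, H, h⟩
  · rw [h] at hd
    rw [hd.eq_zero]
    exact Submodule.zero_mem _
  · rw [h] at hd
    exact Submodule.subset_span ⟨(γ, H), (isDiag_gen γ H).unique hd⟩

/-- The linear span of the operators `T_α (∏_{i ∈ F} Q_i) T_α*`, with `α` a finite (possibly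
empty) word and `F` a finite set of letters. -/
def genSpan (A : ℕ+ → ℕ+ → Prop) : Submodule ℂ (Hilb A →L[ℂ] Hilb A) :=
  Submodule.span ℂ (Set.range fun p : List ℕ+ × Finset ℕ+ => gen A p.1 p.2)

theorem genSpan_mul {R S : Hilb A →L[ℂ] Hilb A} (hR : R ∈ genSpan A) (hS : S ∈ genSpan A) :
    R * S ∈ genSpan A := by
  have h := Submodule.mul_mem_mul hR hS
  rw [genSpan, Submodule.span_mul_span] at h
  refine Submodule.span_le.2 ?_ h
  rintro _ ⟨_, ⟨p, rfl⟩, _, ⟨q, rfl⟩, rfl⟩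
  exact gen_mul_mem _ _ _ _

theorem genSpan_star {R : Hilb A →L[ℂ] Hilb A} (hR : R ∈ genSpan A) : star R ∈ genSpan A := by
  induction hR using Submodule.span_induction with
  | mem x hx =>
    obtain ⟨p, rfl⟩ := hx
    simp only [(isDiag_gen p.1 p.2).star]
    exact Submodule.subset_span ⟨p, rfl⟩
  | zero => simp
  | add x y _ _ hx hy => rw [star_add]; exact Submodule.add_mem _ hx hy
  | smul c x _ hx => rw [star_smul]; exact Submodule.smul_mem _ _ hx

theorem one_mem_genSpan : (1 : Hilb A →L[ℂ] Hilb A) ∈ genSpan A := by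
  refine Submodule.subset_span ⟨([], ∅), (isDiag_gen (A := A) [] ∅).unique ?_⟩
  have h : cyl A [] ∅ = Set.univ := by simp [cyl]
  rw [h]
  exact IsDiag.one

/-- The commutative unital C*-algebra `D_A` of operators on `ℓ²(Σ_A)`: the norm closure of the
linear span of the operators `T_α (∏_{i ∈ F} Q_i) T_α*`. -/
def D (A : ℕ+ → ℕ+ → Prop) : StarSubalgebra ℂ (Hilb A →L[ℂ] Hilb A) where
  carrier := closure (genSpan A : Set (Hilb A →L[ℂ] Hilb A))
  mul_mem' hR hS := map_mem_closure₂ continuous_mul hR hS fun _ h1 _ h2 => genSpan_mul h1 h2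
  add_mem' hR hS := map_mem_closure₂ continuous_add hR hS fun _ h1 _ h2 =>
    Submodule.add_mem _ h1 h2
  algebraMap_mem' c := subset_closure (by
    rw [Algebra.algebraMap_eq_smul_one]
    exact Submodule.smul_mem _ c one_mem_genSpan)
  star_mem' hR := map_mem_closure continuous_star hR fun _ h => genSpan_star h

/-- `T_g = T_{x₁} ⋯ T_{x_n}`, where `x₁ ⋯ x_n` is the reduced form of `g` and
`T_{s⁻¹} = T_s*`. -/
def TGroup (A : ℕ+ → ℕ+ → Prop) (g : FreeGroup ℕ+) : Hilb A →L[ℂ] Hilb A :=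
  (g.toWord.map fun p => if p.2 then T A p.1 else star (T A p.1)).prod

/-- The projection `e_g = T_g T_g*`. -/
def e (A : ℕ+ → ℕ+ → Prop) (g : FreeGroup ℕ+) : Hilb A →L[ℂ] Hilb A :=
  TGroup A g * star (TGroup A g)

theorem isDiag_word (L : List (ℕ+ × Bool)) :
    ∃ U : Set (Shift A), (U = ∅ ∨ ∃ α F, U = cyl A α F) ∧
      IsDiag ((L.map fun p => if p.2 then T A p.1 else star (T A p.1)).prod *
        star (L.map fun p => if p.2 then T A p.1 else star (T A p.1)).prod) U := by
  induction L with
  | nil =>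
    refine ⟨Set.univ, Or.inr ⟨[], ∅, by simp [cyl]⟩, ?_⟩
    simpa using IsDiag.one (A := A)
  | cons p L ih =>
    obtain ⟨U, hU, hd⟩ := ih
    obtain ⟨s, b⟩ := p
    cases b with
    | true =>
      refine ⟨{x | x.1 0 = s ∧ x.tail ∈ U}, ?_, ?_⟩
      · rcases hU with rfl | ⟨α, F, rfl⟩
        · left
          simp
        · exact Or.inr ⟨s :: α, F, rfl⟩
      · simpa [mul_assoc] using hd.conj_T s
    | false =>
      refine ⟨{x | ∃ h : A s (x.1 0), x.cons s h ∈ U}, ?_, ?_⟩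
      · rcases hU with rfl | ⟨α, F, rfl⟩
        · left
          simp
        · exact cyl_preimage s α F
      · simpa [mul_assoc] using hd.conj_star_T s

theorem e_mem_D (g : FreeGroup ℕ+) : e A g ∈ D A := by
  refine subset_closure ?_
  obtain ⟨U, hU, hd⟩ := isDiag_word (A := A) g.toWord
  rcases hU with rfl | ⟨α, F, rfl⟩
  · have h : e A g = 0 := hd.eq_zero
    rw [h]
    exact Submodule.zero_mem _
  · exact Submodule.subset_span ⟨(α, F), (isDiag_gen α F).unique hd⟩

/-- The space `X_A`, the spectrum (space of characters) of `D_A`. For the renewal matrix the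
Exel–Laca algebra is unital, so that `D_A` is its unital version above. -/
abbrev X (A : ℕ+ → ℕ+ → Prop) : Type := WeakDual.characterSpace ℂ (D A)

theorem D_diagonal {R : Hilb A →L[ℂ] Hilb A} (hR : R ∈ D A) (f : Hilb A) (x : Shift A) :
    R f x = R (basisVec x) x * f x := by
  have hc : ∀ g : Hilb A, Continuous fun R : Hilb A →L[ℂ] Hilb A => R g x := by
    intro g
    simp only [← inner_basisVec]
    fun_prop
  have hcl : IsClosed {R : Hilb A →L[ℂ] Hilb A | R f x = R (basisVec x) x * f x} :=
    isClosed_eq (hc f) ((hc _).mul continuous_const)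
  refine closure_minimal ?_ hcl hR
  intro R hR
  induction hR using Submodule.span_induction with
  | mem R hR =>
    obtain ⟨p, rfl⟩ := hR
    simp only [Set.mem_ofPred_eq]
    rw [isDiag_gen, isDiag_gen p.1 p.2 (basisVec x)]
    by_cases h : x ∈ cyl A p.1 p.2 <;> simp [h, basisVec]
  | zero => simp
  | add R S _ _ h1 h2 =>
    simp only [Set.mem_ofPred_eq] at h1 h2 ⊢
    simp [h1, h2, add_mul]
  | smul c R _ h =>
    simp only [Set.mem_ofPred_eq] at h ⊢
    simp [h, mul_assoc]

/-- The inclusion `i₁ : Σ_A → X_A`, sending `x` to the character `R ↦ (R δ_x, δ_x)`. -/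
def i₁ (x : Shift A) : X A :=
  ⟨((innerSL ℂ (basisVec x)).comp (ContinuousLinearMap.apply ℂ (Hilb A) (basisVec x))).comp
      (D A).toSubalgebra.toSubmodule.subtypeL, by
    have happ : ∀ R : D A,
        (((innerSL ℂ (basisVec x)).comp (ContinuousLinearMap.apply ℂ (Hilb A) (basisVec x))).comp
          (D A).toSubalgebra.toSubmodule.subtypeL) R = R.1 (basisVec x) x :=
      fun R => inner_basisVec x _
    refine ⟨fun h => ?_, fun R S => ?_⟩
    · have h1 := (happ 1).symm.trans (DFunLike.congr_fun h (1 : D A))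
      have h2 : ((1 : D A).1 (basisVec x)) x = 0 := h1
      simp [basisVec] at h2
    · refine (happ _).trans (Eq.trans ?_ (congrArg₂ (· * ·) (happ R) (happ S)).symm)
      exact D_diagonal R.2 (S.1 (basisVec x)) x⟩

/-- Configurations: the elements of `{0, 1}^𝔽`, where `𝔽` is the free group on the letters. -/
abbrev Config : Type := FreeGroup ℕ+ → Fin 2

/-- The inclusion `i₂ : X_A → {0, 1}^𝔽`, `φ ↦ (φ(e_g))_g`. (Since `e_g` is idempotent, `φ(e_g)`
is `0` or `1`.) -/
def i₂ (φ : X A) : Config := fun g => if φ ⟨e A g, e_mem_D g⟩ = 1 then 1 else 0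

/-- `Y_A = X_A \ Σ_A`, with `X_A` identified with `i₂(X_A)` and `Σ_A` with `i₂(i₁(Σ_A))`. -/
def Y (A : ℕ+ → ℕ+ → Prop) : Set Config :=
  Set.range (i₂ : X A → Config) \ Set.range fun x : Shift A => i₂ (i₁ x)

/-- The positive cone `𝔽₊`: the unital sub-semigroup of `𝔽` generated by the letters. -/
def positiveCone : Submonoid (FreeGroup ℕ+) := Submonoid.closure (Set.range FreeGroup.of)

/-- The element `ω₀ω₁⋯ω_{n-1}` of `𝔽` given by a finite list of letters. -/
def wordProd (w : List ℕ+) : FreeGroup ℕ+ := (w.map FreeGroup.of).prod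

/-- Positive words: finite (possibly empty) or infinite sequences of letters. -/
inductive PosWord : Type
  | finite (w : List ℕ+) : PosWord
  | infinite (w : ℕ → ℕ+) : PosWord

/-- `A(ω_j, ω_{j+1}) = 1` for all `j`. -/
def PosWord.Admissible (A : ℕ+ → ℕ+ → Prop) : PosWord → Prop
  | .finite w => w.IsChain A
  | .infinite w => ∀ j, A (w j) (w (j + 1))

/-- The length of a positive word. -/
def PosWord.length : PosWord → ℕ∞
  | .finite w => w.length
  | .infinite _ => ⊤

/-- The set `⟦ω⟧ = {e, ω₀, ω₀ω₁, ω₀ω₁ω₂, …}`. -/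
def PosWord.subwords : PosWord → Set (FreeGroup ℕ+)
  | .finite w => {g | ∃ v, v <+: w ∧ g = wordProd v}
  | .infinite w => {g | ∃ n, g = wordProd (List.ofFn fun k : Fin n => w k)}

/-- `ω` is the stem of `ξ`: it is admissible and `{g : ξ_g = 1} ∩ 𝔽₊ = ⟦ω⟧`. (Such an `ω` is
unique, since `⟦ω⟧` determines `ω`.) -/
def IsStem (A : ℕ+ → ℕ+ → Prop) (ξ : Config) (ω : PosWord) : Prop :=
  ω.Admissible A ∧ {g | ξ g = 1} ∩ positiveCone = ω.subwords

/-- The stem of `ξ` has length `n`. -/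
def HasStemLength (A : ℕ+ → ℕ+ → Prop) (ξ : Config) (n : ℕ∞) : Prop :=
  ∃ ω, IsStem A ξ ω ∧ ω.length = n

/-- The configuration `ξ⁰` of the renewal shift, filled exactly at the group identity and at the
inverses `ω⁻¹` of the nonempty finite admissible positive words `ω` that end with the letter
`1`. -/
def xi0 : Config := fun g =>
  if ∃ w : List ℕ+, w.IsChain renewal ∧ (w = [] ∨ w.getLast? = some 1) ∧ g = (wordProd w)⁻¹
  then 1 else 0

end RenewalShift

end

namespace RenewalShift

open Classical

variable {A : ℕ+ → ℕ+ → Prop}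

/-! ### Positive words in the free group -/

/-! Every `e_g` is the diagonal projection onto a set `wordSet`. A letter `n + 1` can be followed
only by `n`, and `1` by anything, so for the renewal matrix each such set is empty or a plain
cylinder (`wordSet_renewal`). Thus `e_g` is `0` or equals `e_γ` for a positive word `γ`, and a
configuration with a finite stem is determined by it (`i₂_eq_of_isStem`). Points of `Σ_A` have
infinite stems, so every configuration of `X_A` with a finite stem lies in `Y_A`.

A nonempty finite stem must end in `1`: after `k + 1` the letter `k` is forced, so the stem would
continue (`isStem_getLast`). Conversely, if `w` is admissible and is empty or ends in `1`, the
points `w k (k-1) ⋯ 2 1 1 ⋯` with `k → ∞` accumulate, by compactness of the character space, at a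
character with stem `w` (`exists_isStem`).

So for `n ≥ 1` the elements with stem length `n` correspond to admissible words of length `n` ending
in `1`. Exactly two letters, `1` and `b + 1`, can precede `b`, which gives `2^(n-1)` words. With
empty stem, `ξ_g = 1` exactly when `e_g = 1`, and `wordSet_eq_univ_iff` identifies these `g` as
those filled in `xi0`. -/

theorem wordProd_eq_mk (w : List ℕ+) : wordProd w = FreeGroup.mk (w.map (·, true)) := by
  induction w with
  | nil => rfl
  | cons a w ih =>
    have h : wordProd (a :: w) = FreeGroup.of a * wordProd w := by simp [wordProd]
    rw [h, ih, FreeGroup.of, FreeGroup.mul_mk]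
    rfl

theorem isReduced_positive (w : List ℕ+) : FreeGroup.IsReduced (w.map (·, true)) := by
  rw [FreeGroup.IsReduced, List.isChain_map]
  induction w with
  | nil => simp
  | cons a w ih => cases w <;> simp_all

theorem toWord_wordProd (w : List ℕ+) : (wordProd w).toWord = w.map (·, true) := by
  rw [wordProd_eq_mk, FreeGroup.toWord_mk, (isReduced_positive w).reduce_eq]

theorem wordProd_injective : Function.Injective wordProd := by
  intro v w h
  have h' := congrArg FreeGroup.toWord h
  rw [toWord_wordProd, toWord_wordProd] at h'
  exact List.map_injective_iff.2 (fun a b h => congrArg Prod.fst h) h'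

theorem wordProd_mem_positiveCone (w : List ℕ+) : wordProd w ∈ positiveCone := by
  refine Submonoid.list_prod_mem _ fun g hg => ?_
  obtain ⟨a, -, rfl⟩ := List.mem_map.1 hg
  exact Submonoid.subset_closure ⟨a, rfl⟩

theorem exists_wordProd_of_mem_positiveCone {g : FreeGroup ℕ+} (hg : g ∈ positiveCone) :
    ∃ w, g = wordProd w := by
  induction hg using Submonoid.closure_induction with
  | mem x hx =>
    obtain ⟨a, rfl⟩ := hx
    exact ⟨[a], by simp [wordProd]⟩
  | one => exact ⟨[], rfl⟩
  | mul x y _ _ hx hy =>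
    obtain ⟨v, rfl⟩ := hx
    obtain ⟨w, rfl⟩ := hy
    exact ⟨v ++ w, by simp [wordProd]⟩

theorem isStem_finite_iff {ξ : Config} {w : List ℕ+} :
    IsStem A ξ (.finite w) ↔ w.IsChain A ∧ ∀ v, ξ (wordProd v) = 1 ↔ v <+: w := by
  refine and_congr_right fun _ => ⟨fun h v => ?_, fun h => ?_⟩
  · have h' := Set.ext_iff.1 h (wordProd v)
    constructor
    · intro hv
      obtain ⟨u, hu, huv⟩ := h'.1 ⟨hv, wordProd_mem_positiveCone v⟩
      rwa [wordProd_injective huv]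
    · intro hv
      exact (h'.2 ⟨v, hv, rfl⟩).1
  · ext g
    constructor
    · rintro ⟨h1, h2⟩
      obtain ⟨v, rfl⟩ := exists_wordProd_of_mem_positiveCone h2
      exact ⟨v, (h v).1 h1, rfl⟩
    · rintro ⟨v, hv, rfl⟩
      exact ⟨(h v).2 hv, wordProd_mem_positiveCone v⟩

theorem hasStemLength_natCast_iff {ξ : Config} {n : ℕ} :
    HasStemLength A ξ n ↔ ∃ w, IsStem A ξ (.finite w) ∧ w.length = n := by
  constructor
  · rintro ⟨w | w, h1, h2⟩
    · exact ⟨w, h1, by simpa [PosWord.length] using h2⟩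
    · simp [PosWord.length] at h2
  · rintro ⟨w, h1, h2⟩
    exact ⟨_, h1, by simp [PosWord.length, h2]⟩

/-! ### The sets of points on which the projections `e_g` are supported -/

/-- The set of points `x` such that `T_L T_L* δ_x = δ_x`, where `L` is a word in the letters and
their inverses. -/
def wordSet (A : ℕ+ → ℕ+ → Prop) : List (ℕ+ × Bool) → Set (Shift A)
  | [] => Set.univ
  | (s, true) :: L => {x | x.1 0 = s ∧ x.tail ∈ wordSet A L}
  | (s, false) :: L => {x | ∃ h : A s (x.1 0), x.cons s h ∈ wordSet A L}

theorem isDiag_wordSet (L : List (ℕ+ × Bool)) :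
    IsDiag ((L.map fun p => if p.2 then T A p.1 else star (T A p.1)).prod *
      star (L.map fun p => if p.2 then T A p.1 else star (T A p.1)).prod) (wordSet A L) := by
  induction L with
  | nil => simpa [wordSet] using IsDiag.one (A := A)
  | cons p L ih =>
    obtain ⟨s, b⟩ := p
    cases b with
    | true => simpa [mul_assoc, wordSet] using ih.conj_T s
    | false => simpa [mul_assoc, wordSet] using ih.conj_star_T s

theorem isDiag_e (g : FreeGroup ℕ+) : IsDiag (e A g) (wordSet A g.toWord) := isDiag_wordSet _

theorem wordSet_positive (w : List ℕ+) : wordSet A (w.map (·, true)) = cyl A w ∅ := by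
  induction w with
  | nil => simp [wordSet, cyl]
  | cons a w ih => simp [wordSet, cyl, ih]

theorem wordSet_eq_empty_or_cyl (L : List (ℕ+ × Bool)) :
    wordSet A L = ∅ ∨ ∃ α F, wordSet A L = cyl A α F := by
  induction L with
  | nil => exact Or.inr ⟨[], ∅, by simp [wordSet, cyl]⟩
  | cons p L ih =>
    obtain ⟨s, b⟩ := p
    rcases ih with h | ⟨α, F, h⟩
    · left
      cases b <;> simp [wordSet, h]
    · cases b with
      | true => exact Or.inr ⟨s :: α, F, by simp [wordSet, cyl, h]⟩
      | false =>
        simp only [wordSet, h]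
        exact cyl_preimage s α F

theorem renewal_add_one (n m : ℕ+) : renewal (n + 1) m ↔ m = n := by
  have h : n + 1 ≠ 1 := (PNat.lt_add_left 1 n).ne'
  simp [renewal, h, eq_comm]

/-- The constraint imposed by `1 ∈ F` is vacuous, and one imposed by `n + 1 ∈ F` fixes the next
letter as `n`. So `F` is vacuous, amounts to one more letter, or is contradictory. -/
theorem cyl_renewal (α : List ℕ+) (F : Finset ℕ+) :
    cyl renewal α F = ∅ ∨ ∃ γ, cyl renewal α F = cyl renewal γ ∅ := by
  induction α with
  | nil =>
    by_cases h : ∀ i ∈ F, i = 1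
    · refine Or.inr ⟨[], ?_⟩
      ext x
      simp only [cyl, Set.mem_ofPred_eq, Finset.notMem_empty, false_imp_iff, implies_true, iff_true]
      exact fun i hi => Or.inl (h i hi)
    · push Not at h
      obtain ⟨i, hi, hi1⟩ := h
      obtain ⟨n, rfl⟩ := PNat.exists_eq_succ_of_ne_one hi1
      by_cases hn : ∀ j ∈ F, renewal j n
      · refine Or.inr ⟨[n], ?_⟩
        ext x
        simp only [cyl, Set.mem_ofPred_eq, Finset.notMem_empty, false_imp_iff, implies_true,
          and_true]
        exact ⟨fun h => (renewal_add_one _ _).1 (h _ hi), fun h => h ▸ hn⟩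
      · left
        ext x
        simp only [cyl, Set.mem_ofPred_eq, Set.mem_empty_iff_false, iff_false]
        exact fun h => hn ((renewal_add_one _ _).1 (h _ hi) ▸ h)
  | cons a α ih =>
    rcases ih with h | ⟨γ, h⟩
    · left
      simp [cyl, h]
    · exact Or.inr ⟨a :: γ, by simp [cyl, h]⟩

theorem wordSet_renewal (L : List (ℕ+ × Bool)) :
    wordSet renewal L = ∅ ∨ ∃ γ, wordSet renewal L = cyl renewal γ ∅ := by
  rcases wordSet_eq_empty_or_cyl (A := renewal) L with h | ⟨α, F, h⟩
  · exact Or.inl h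
  · rw [h]
    exact cyl_renewal α F

theorem isDiag_e_wordProd (w : List ℕ+) : IsDiag (e A (wordProd w)) (cyl A w ∅) := by
  have h := isDiag_e (A := A) (wordProd w)
  rwa [toWord_wordProd, wordSet_positive] at h

/-! ### Characters -/

theorem i₂_eq_one {φ : X A} {g : FreeGroup ℕ+} : i₂ φ g = 1 ↔ φ ⟨e A g, e_mem_D g⟩ = 1 := by
  by_cases h : φ ⟨e A g, e_mem_D g⟩ = 1 <;> simp [i₂, h]

theorem i₂_congr (φ : X A) {g h : FreeGroup ℕ+} (hgh : e A g = e A h) : i₂ φ g = i₂ φ h := by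
  simp only [i₂, hgh]

theorem i₂_ne_one_of_e_eq_zero (φ : X A) {g : FreeGroup ℕ+} (hg : e A g = 0) : i₂ φ g ≠ 1 := by
  rw [Ne, i₂_eq_one]
  have h : (⟨e A g, e_mem_D g⟩ : D A) = 0 := Subtype.ext hg
  rw [h, map_zero]
  exact zero_ne_one

theorem i₁_apply (x : Shift A) (R : D A) : i₁ x R = R.1 (basisVec x) x := inner_basisVec x _

theorem i₁_apply_of_isDiag {x : Shift A} {R : D A} {U : Set (Shift A)} (hR : IsDiag R.1 U) :
    i₁ x R = if x ∈ U then 1 else 0 := by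
  rw [i₁_apply, hR]
  simp [basisVec]

theorem i₂_i₁_eq_one {x : Shift A} {g : FreeGroup ℕ+} :
    i₂ (i₁ x) g = 1 ↔ x ∈ wordSet A g.toWord := by
  rw [i₂_eq_one, i₁_apply_of_isDiag (isDiag_e g)]
  by_cases h : x ∈ wordSet A g.toWord <;> simp [h]

theorem config_eq_of_eq_one_iff {ξ η : Config} (h : ∀ g, ξ g = 1 ↔ η g = 1) : ξ = η := by
  funext g
  have := h g
  grind

theorem i₂_eq_of_isStem {φ ψ : X renewal} {w : List ℕ+}
    (hφ : IsStem renewal (i₂ φ) (.finite w)) (hψ : IsStem renewal (i₂ ψ) (.finite w)) :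
    i₂ φ = i₂ ψ := by
  refine config_eq_of_eq_one_iff fun g => ?_
  have hd := isDiag_e (A := renewal) g
  rcases wordSet_renewal g.toWord with h | ⟨γ, h⟩
  · rw [h] at hd
    exact iff_of_false (i₂_ne_one_of_e_eq_zero φ hd.eq_zero) (i₂_ne_one_of_e_eq_zero ψ hd.eq_zero)
  · rw [h] at hd
    have he := hd.unique (isDiag_e_wordProd γ)
    rw [i₂_congr φ he, i₂_congr ψ he, (isStem_finite_iff.1 hφ).2, (isStem_finite_iff.1 hψ).2]

theorem mem_cyl_ofFn (x : Shift A) (n : ℕ) :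
    x ∈ cyl A (List.ofFn fun k : Fin n => x.1 k) ∅ := by
  induction n generalizing x with
  | zero => simp [cyl]
  | succ n ih =>
    rw [List.ofFn_succ]
    exact ⟨rfl, ih x.tail⟩

theorem not_isStem_i₂_i₁ (x : Shift A) (w : List ℕ+) : ¬ IsStem A (i₂ (i₁ x)) (.finite w) := by
  intro h
  -- All initial segments of `x` are filled; one letter more than `w` has is enough for a
  -- contradiction.
  have h1 : i₂ (i₁ x) (wordProd (List.ofFn fun k : Fin (w.length + 1) => x.1 k)) = 1 := by
    rw [i₂_i₁_eq_one, toWord_wordProd, wordSet_positive]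
    exact mem_cyl_ofFn x _
  simpa using (((isStem_finite_iff.1 h).2 _).1 h1).length_le

theorem mem_Y_of_isStem {φ : X A} {w : List ℕ+} (h : IsStem A (i₂ φ) (.finite w)) :
    i₂ φ ∈ Y A := by
  refine ⟨⟨φ, rfl⟩, ?_⟩
  rintro ⟨x, hx⟩
  change i₂ (i₁ x) = i₂ φ at hx
  exact not_isStem_i₂_i₁ x w (hx ▸ h)

/-- A sequence of points of `Σ_A` on which every `e_g` is eventually constant has a limit
character. -/
theorem exists_limit_character (x : ℕ → Shift A) :
    ∃ φ : X A, ∀ g, ((∀ᶠ k in Filter.atTop, x k ∈ wordSet A g.toWord) → i₂ φ g = 1) ∧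
      ((∀ᶠ k in Filter.atTop, x k ∉ wordSet A g.toWord) → i₂ φ g ≠ 1) := by
  -- Completeness of `D A` makes its character space compact, so an ultrafilter finer than the image
  -- of `atTop` converges; no convergent subsequence is needed.
  have hclosed : IsClosed (D A : Set (Hilb A →L[ℂ] Hilb A)) := isClosed_closure
  have : CompleteSpace (D A) := hclosed.completeSpace_coe
  have : CompactSpace (X A) := inferInstance
  let U : Ultrafilter (X A) := Ultrafilter.of (Filter.map (fun k => i₁ (x k)) Filter.atTop)
  have hU : (U : Filter (X A)) ≤ Filter.map (fun k => i₁ (x k)) Filter.atTop := Ultrafilter.of_le _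
  refine ⟨U.lim, fun g => ?_⟩
  have hc : Continuous fun ψ : X A => ψ ⟨e A g, e_mem_D g⟩ :=
    (WeakDual.eval_continuous _).comp continuous_subtype_val
  have hlim : ∀ c : ℂ, (∀ᶠ k in Filter.atTop, i₁ (x k) ⟨e A g, e_mem_D g⟩ = c) →
      U.lim ⟨e A g, e_mem_D g⟩ = c := by
    intro c hk
    have h1 : ∀ᶠ ψ : X A in U, ψ ⟨e A g, e_mem_D g⟩ = c := hU (Filter.eventually_map.2 hk)
    exact tendsto_nhds_unique ((hc.tendsto U.lim).mono_left U.le_nhds_lim)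
      (tendsto_const_nhds.congr' (h1.mono fun _ h => h.symm))
  have hval : ∀ k, i₁ (x k) ⟨e A g, e_mem_D g⟩ = if x k ∈ wordSet A g.toWord then 1 else 0 :=
    fun k => i₁_apply_of_isDiag (isDiag_e g)
  simp only [hval] at hlim
  rw [Ne, i₂_eq_one]
  constructor
  · intro h
    refine hlim 1 (h.mono fun k hk => ?_)
    simp [hk]
  · intro h
    rw [hlim 0 (h.mono fun k hk => ?_)]
    · exact zero_ne_one
    · simp [hk]

/-! ### Points of the renewal shift -/

/-- The point `k (k - 1) ⋯ 2 1 1 1 ⋯`. -/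
def descent (k : ℕ+) : Shift renewal where
  -- Truncated subtraction reaches `0`, and `toPNat'` sends `0` to `1`: this produces the tail of
  -- ones.
  val j := ((k : ℕ) - j).toPNat'
  property j := by
    by_cases h : (k : ℕ) - j ≤ 1
    · left
      apply PNat.eq
      rw [Nat.toPNat'_coe]
      split <;> simp; omega
    · right
      apply PNat.eq
      rw [PNat.add_coe, Nat.toPNat'_coe, Nat.toPNat'_coe, if_pos (by omega), if_pos (by omega)]
      simp
      omega

theorem descent_zero (k : ℕ+) : (descent k).1 0 = k := by
  apply PNat.eq
  simp [descent]

/-- The point is the concatenation `w y`. The clause on `head?` lets the induction check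
admissibility of the next letter put in front. -/
theorem exists_append (w : List ℕ+) (y : Shift A) (h : (w ++ [y.1 0]).IsChain A) :
    ∃ x : Shift A, (w ++ [y.1 0]).head? = some (x.1 0) ∧
      ∀ γ, x ∈ cyl A γ ∅ ↔ γ <+: w ∨ ∃ γ', γ = w ++ γ' ∧ y ∈ cyl A γ' ∅ := by
  induction w with
  | nil =>
    refine ⟨y, rfl, fun γ => ?_⟩
    constructor
    · exact fun hy => Or.inr ⟨γ, rfl, hy⟩
    · rintro (h | ⟨γ', rfl, h⟩)
      · simp [List.prefix_nil.1 h, cyl]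
      · exact h
  | cons a w ih =>
    rw [List.cons_append, List.isChain_cons] at h
    obtain ⟨x, hx0, hx⟩ := ih h.2
    refine ⟨x.cons a (h.1 _ hx0), rfl, fun γ => ?_⟩
    cases γ with
    | nil => simp [cyl]
    | cons b γ =>
      have h0 : (x.cons a (h.1 _ hx0)).1 0 = a := rfl
      simp only [cyl, Set.mem_ofPred_eq, h0, Shift.tail_cons, hx, List.cons_prefix_cons,
        List.cons_append, List.cons.injEq]
      grind

theorem cyl_renewal_eq_univ {γ : List ℕ+} (h : cyl renewal γ ∅ = Set.univ) : γ = [] := by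
  cases γ with
  | nil => rfl
  | cons a γ =>
    have h1 : descent (a + 1) ∈ cyl renewal (a :: γ) ∅ := h ▸ Set.mem_univ _
    have h2 := h1.1
    rw [descent_zero] at h2
    exact absurd h2 (PNat.lt_add_right a 1).ne'

theorem renewal_chain_append {w : List ℕ+} (hw : w.IsChain renewal)
    (h1 : w = [] ∨ w.getLast? = some 1) (m : ℕ+) : (w ++ [m]).IsChain renewal := by
  rw [List.isChain_append]
  refine ⟨hw, by simp, fun a ha b _ => Or.inl ?_⟩
  rcases h1 with rfl | h1
  · simp at ha
  · rw [h1] at ha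
    exact (Option.some_inj.1 ha).symm

/-- The letter after `w` in the approximating points tends to infinity, so each cylinder properly
extending `w` is eventually left, while the cylinders of prefixes of `w` contain all the points. -/
theorem exists_isStem {w : List ℕ+} (hw : w.IsChain renewal)
    (h1 : w = [] ∨ w.getLast? = some 1) :
    ∃ φ : X renewal, IsStem renewal (i₂ φ) (.finite w) := by
  have hex : ∀ k : ℕ, ∃ x : Shift renewal, ∀ γ, x ∈ cyl renewal γ ∅ ↔
      γ <+: w ∨ ∃ γ', γ = w ++ γ' ∧ descent k.succPNat ∈ cyl renewal γ' ∅ := fun k =>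
    (exists_append w (descent k.succPNat) (renewal_chain_append hw h1 _)).imp fun _ h => h.2
  choose x hx using hex
  obtain ⟨φ, hφ⟩ := exists_limit_character x
  refine ⟨φ, isStem_finite_iff.2 ⟨hw, fun γ => ?_⟩⟩
  have h := hφ (wordProd γ)
  rw [toWord_wordProd, wordSet_positive] at h
  constructor
  · contrapose!
    refine fun hγ => h.2 ?_
    simp only [hx, hγ, false_or]
    by_cases hp : ∃ m γ', γ = w ++ m :: γ'
    · obtain ⟨m, γ', rfl⟩ := hp
      -- The letter after `w` in the point of index `k` is `k + 1`, which differs from `m` once `k >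
      -- m`.
      filter_upwards [Filter.eventually_gt_atTop (m : ℕ)] with k hk
      rintro ⟨γ'', h2, h3⟩
      rw [← List.append_cancel_left h2] at h3
      have h4 := h3.1
      rw [descent_zero] at h4
      have h5 := congrArg PNat.val h4
      simp at h5
      omega
    · refine Filter.Eventually.of_forall fun k => ?_
      rintro ⟨γ', rfl, -⟩
      cases γ' with
      | nil => simp at hγ
      | cons m γ' => exact hp ⟨m, γ', rfl⟩
  · exact fun hγ => h.1 (Filter.Eventually.of_forall fun k => (hx k γ).2 (Or.inl hγ))

/-- The letter `k + 1` has `k` as its only successor. -/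
theorem cyl_append_of_chain {w : List ℕ+} {k : ℕ+} (h : w.getLast? = some (k + 1)) :
    cyl renewal w ∅ = cyl renewal (w ++ [k]) ∅ := by
  induction w with
  | nil => simp at h
  | cons a w ih =>
    cases w with
    | nil =>
      ext x
      have ha : a = k + 1 := by simpa using h
      simp only [cyl, List.cons_append, List.nil_append, Set.mem_ofPred_eq, Finset.notMem_empty,
        false_imp_iff, implies_true, and_true]
      refine ⟨fun hx => ⟨hx, (renewal_add_one _ _).1 ?_⟩, And.left⟩
      rw [← ha, ← hx]
      exact x.2 0
    | cons b w =>
      have := ih (by simpa using h)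
      simp only [List.cons_append] at this ⊢
      rw [cyl, this]
      rfl

theorem isStem_getLast {φ : X renewal} {w : List ℕ+} (h : IsStem renewal (i₂ φ) (.finite w)) :
    w = [] ∨ w.getLast? = some 1 := by
  by_contra! hw
  obtain ⟨a, ha⟩ := Option.ne_none_iff_exists'.1 (mt List.getLast?_eq_none_iff.1 hw.1)
  have ha1 : a ≠ 1 := by
    rintro rfl
    exact hw.2 ha
  obtain ⟨k, rfl⟩ := PNat.exists_eq_succ_of_ne_one ha1
  have hd := isDiag_e_wordProd (A := renewal) w
  rw [cyl_append_of_chain ha] at hd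
  have he := i₂_congr φ (hd.unique (isDiag_e_wordProd _))
  rw [((isStem_finite_iff.1 h).2 w).2 (List.prefix_refl w)] at he
  simpa using (((isStem_finite_iff.1 h).2 _).1 he.symm).length_le

/-! ### The configuration with empty stem -/

/-- The letters of `r` are put in front of `x` one after another, so `r` lists them against the
reading direction; hence `flip A`. -/
theorem mem_wordSet_inverse (r : List ℕ+) (x : Shift A) :
    x ∈ wordSet A (r.map (·, false)) ↔ (x.1 0 :: r).IsChain (flip A) := by
  induction r generalizing x with
  | nil => simp [wordSet]
  | cons s r ih =>
    simp only [List.map_cons, wordSet, Set.mem_ofPred_eq, ih, List.isChain_cons_cons]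
    exact ⟨fun ⟨h, h'⟩ => ⟨h, h'⟩, fun ⟨h, h'⟩ => ⟨h, h'⟩⟩

/-- If `s⁻¹` were followed by a positive letter, membership would force that letter to be `s`, the
first letter of `s x`, and the word would not be reduced. -/
theorem eq_inverse_or_head_of_mem_wordSet {L : List (ℕ+ × Bool)} (hL : FreeGroup.IsReduced L)
    {x : Shift A} (hx : x ∈ wordSet A L) :
    (∃ r : List ℕ+, L = r.map (·, false)) ∨ L.head? = some (x.1 0, true) := by
  induction L generalizing x with
  | nil => exact Or.inl ⟨[], rfl⟩
  | cons p L ih =>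
    obtain ⟨s, b⟩ := p
    cases b with
    | true =>
      right
      rw [hx.1]
      rfl
    | false =>
      left
      obtain ⟨h, hx⟩ := hx
      rw [FreeGroup.IsReduced, List.isChain_cons] at hL
      rcases ih hL.2 hx with ⟨r, rfl⟩ | h'
      · exact ⟨s :: r, rfl⟩
      · simpa using hL.1 _ h' rfl

theorem wordProd_inv (w : List ℕ+) : (wordProd w)⁻¹ = FreeGroup.mk (w.reverse.map (·, false)) := by
  rw [wordProd_eq_mk, FreeGroup.inv_mk]
  simp [FreeGroup.invRev, Function.comp_def]

theorem toWord_wordProd_inv (w : List ℕ+) :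
    (wordProd w)⁻¹.toWord = w.reverse.map (·, false) := by
  rw [FreeGroup.toWord_inv, toWord_wordProd]
  simp [FreeGroup.invRev, Function.comp_def]

theorem wordSet_eq_univ_iff (g : FreeGroup ℕ+) :
    wordSet renewal g.toWord = Set.univ ↔
      ∃ w : List ℕ+, w.IsChain renewal ∧ (w = [] ∨ w.getLast? = some 1) ∧ g = (wordProd w)⁻¹ := by
  constructor
  · intro h
    have hmem : ∀ x, x ∈ wordSet renewal g.toWord := Set.eq_univ_iff_forall.1 h
    have hr : ∃ r : List ℕ+, g.toWord = r.map (·, false) := by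
      by_contra hr
      -- A positive first letter would have to be the initial letter of every point, but `descent 1`
      -- and `descent 2` start differently.
      have h1 := (eq_inverse_or_head_of_mem_wordSet FreeGroup.isReduced_toWord
        (hmem (descent 1))).resolve_left hr
      have h2 := (eq_inverse_or_head_of_mem_wordSet FreeGroup.isReduced_toWord
        (hmem (descent 2))).resolve_left hr
      rw [h1, descent_zero, descent_zero] at h2
      simp at h2
    obtain ⟨r, hr⟩ := hr
    simp only [hr, mem_wordSet_inverse] at hmem
    refine ⟨r.reverse, ?_, ?_, ?_⟩
    · rw [List.isChain_reverse]
      exact (hmem (descent 1)).tail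
    · cases r with
      | nil => simp
      | cons a r =>
        right
        -- Testing on a point that starts with `a` itself gives `A(a, a) = 1`, which holds only for
        -- `a = 1`.
        have ha := hmem (descent a)
        rw [List.isChain_cons_cons, descent_zero, flip, renewal] at ha
        rcases ha.1 with h | h
        · simp [h]
        · exact absurd h (PNat.lt_add_right a 1).ne
    · rw [wordProd_inv, List.reverse_reverse, ← hr, FreeGroup.mk_toWord]
  · rintro ⟨w, hw, h1, rfl⟩
    refine Set.eq_univ_of_forall fun x => ?_
    rw [toWord_wordProd_inv, mem_wordSet_inverse]
    have h := renewal_chain_append hw h1 (x.1 0)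
    rwa [← List.reverse_reverse (w ++ [x.1 0]), List.isChain_reverse, List.reverse_append] at h

theorem i₂_eq_xi0 {φ : X renewal} (h : IsStem renewal (i₂ φ) (.finite [])) : i₂ φ = xi0 := by
  refine config_eq_of_eq_one_iff fun g => ?_
  have hx : xi0 g = 1 ↔ wordSet renewal g.toWord = Set.univ := by
    rw [wordSet_eq_univ_iff, xi0]
    split <;> simp_all
  rw [hx]
  have hd := isDiag_e (A := renewal) g
  rcases wordSet_renewal g.toWord with h0 | ⟨γ, h0⟩
  · rw [h0] at hd ⊢
    refine iff_of_false (i₂_ne_one_of_e_eq_zero φ hd.eq_zero) fun he => ?_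
    exact (he ▸ Set.mem_univ (descent 1) : descent 1 ∈ (∅ : Set (Shift renewal)))
  · rw [h0] at hd ⊢
    rw [i₂_congr φ (hd.unique (isDiag_e_wordProd γ)), (isStem_finite_iff.1 h).2, List.prefix_nil]
    refine ⟨?_, cyl_renewal_eq_univ⟩
    rintro rfl
    simp [cyl]

/-! ### Counting the stems -/

/-- The admissible words of length `n` that end with the letter `1`. -/
def stems (n : ℕ) : Set (List ℕ+) :=
  {w | w.length = n ∧ w.IsChain renewal ∧ w.getLast? = some 1}

theorem stems_one : stems 1 = {[1]} := by
  ext w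
  simp only [stems, Set.mem_ofPred_eq, Set.mem_singleton_iff, List.length_eq_one_iff]
  constructor
  · rintro ⟨⟨a, rfl⟩, -, h⟩
    simpa using h
  · rintro rfl
    simp

/-- Column `b` of the matrix has exactly two ones, in rows `1` and `b + 1`. The default value of
`headI` plays no role, since words in `stems n` are nonempty. -/
theorem stems_succ {n : ℕ} (hn : 1 ≤ n) :
    stems (n + 1) = (fun w => 1 :: w) '' stems n ∪ (fun w => (w.headI + 1) :: w) '' stems n := by
  ext w
  simp only [stems, Set.mem_union, Set.mem_image, Set.mem_ofPred_eq]
  constructor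
  · rintro ⟨h1, h2, h3⟩
    obtain _ | ⟨a, _ | ⟨b, w⟩⟩ := w
    · simp at h1
    · simp at h1
      omega
    · rw [List.isChain_cons_cons] at h2
      have hw : (b :: w).length = n ∧ (b :: w).IsChain renewal ∧ (b :: w).getLast? = some 1 :=
        ⟨by simpa using h1, h2.2, by simpa using h3⟩
      rcases h2.1 with rfl | rfl
      · exact Or.inl ⟨_, hw, rfl⟩
      · exact Or.inr ⟨_, hw, rfl⟩
  · rintro (⟨v, ⟨h1, h2, h3⟩, rfl⟩ | ⟨v, ⟨h1, h2, h3⟩, rfl⟩) <;>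
    · obtain _ | ⟨b, v⟩ := v
      · simp at h3
      · simp_all [renewal]

theorem encard_stems (n : ℕ) : (stems (n + 1)).encard = ((2 ^ n : ℕ) : ℕ∞) := by
  induction n with
  | zero => simp [stems_one]
  | succ n ih =>
    rw [stems_succ (by omega), Set.encard_union_eq, Function.Injective.encard_image,
      Function.Injective.encard_image, ih]
    · rw [pow_succ, mul_two, Nat.cast_add]
    · intro v w h
      exact (List.cons.inj h).2
    · intro v w h
      exact (List.cons.inj h).2
    -- The two images are disjoint because their words begin with `1` and with a letter `b + 1 ≠ 1`,
    -- respectively.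
    · rw [Set.disjoint_left]
      rintro _ ⟨v, -, rfl⟩ ⟨w, -, h⟩
      exact (PNat.lt_add_left 1 w.headI).ne' (List.cons.inj h).1

end RenewalShift

open RenewalShift in
theorem mainTheorem5 :
    {ξ ∈ RenewalShift.Y RenewalShift.renewal |
        RenewalShift.HasStemLength RenewalShift.renewal ξ 0} = {RenewalShift.xi0} ∧
    ∀ n : ℕ, 1 ≤ n →
      {ξ ∈ RenewalShift.Y RenewalShift.renewal |
        RenewalShift.HasStemLength RenewalShift.renewal ξ n}.encard = ((2 ^ (n - 1) : ℕ) : ℕ∞) := by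
  constructor
  · ext ξ
    rw [← Nat.cast_zero]
    simp only [Set.mem_ofPred_eq, Set.mem_singleton_iff, hasStemLength_natCast_iff,
      List.length_eq_zero_iff]
    constructor
    · rintro ⟨⟨⟨φ, rfl⟩, -⟩, w, hw, rfl⟩
      exact i₂_eq_xi0 hw
    · rintro rfl
      obtain ⟨φ, hφ⟩ := exists_isStem (w := []) (by simp) (Or.inl rfl)
      rw [← i₂_eq_xi0 hφ]
      exact ⟨mem_Y_of_isStem hφ, [], hφ, rfl⟩
  · intro n hn
    obtain ⟨n, rfl⟩ := Nat.exists_eq_add_of_le' hn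
    have hex : ∀ w : stems (n + 1), ∃ φ : X renewal, IsStem renewal (i₂ φ) (.finite w.1) :=
      fun w => exists_isStem w.2.2.1 (Or.inr w.2.2.2)
    choose φ hφ using hex
    have hrange : {ξ ∈ Y renewal | HasStemLength renewal ξ (n + 1 : ℕ)} =
        Set.range fun w => i₂ (φ w) := by
      ext ξ
      simp only [Set.mem_ofPred_eq, hasStemLength_natCast_iff]
      constructor
      · rintro ⟨⟨⟨ψ, rfl⟩, -⟩, w, hw, hlen⟩
        have h1 := (isStem_getLast hw).resolve_left (by rintro rfl; simp at hlen)
        exact ⟨⟨w, hlen, hw.1, h1⟩, i₂_eq_of_isStem (hφ _) hw⟩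
      · rintro ⟨w, rfl⟩
        exact ⟨mem_Y_of_isStem (hφ w), w.1, hφ w, w.2.1⟩
    have hinj : Function.Injective fun w => i₂ (φ w) := by
      intro v w h
      have hv := (isStem_finite_iff.1 (hφ v)).2
      have hw := (isStem_finite_iff.1 (hφ w)).2
      have h' : i₂ (φ v) = i₂ (φ w) := h
      -- Equal configurations fill the same positive words, so one stem is a prefix of the other,
      -- and their lengths agree.
      have hp : v.1 <+: w.1 := (hw _).1 (h' ▸ (hv _).2 (List.prefix_refl _))
      exact Subtype.ext (hp.eq_of_length (v.2.1.trans w.2.1.symm))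
    rw [hrange, ← Set.image_univ, hinj.encard_image, Set.encard_univ, ← Set.encard, encard_stems,
      Nat.add_sub_cancel]
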